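/- Let $\mathbb R^2_+=(0,\infty)\times(0,\infty)$ with Lebesgue measure $dr\,ds$, let $L^2(\mathbb R^2_+)$ be the corresponding complex Hilbert space with inner product $\langle\cdot,\cdot\rangle$, and let $\alpha,\beta>-1$. Let $G^\circ_{\alpha,\beta}$ be the operator $$G^\circ_{\alpha,\beta}=\Big(-\frac{\partial^2}{\partial r^2}+\frac{\alpha^2-1/4}{r^2}\Big)+r^2\Big(-\frac{\partial^2}{\partial s^2}+\frac{\beta^2-1/4}{s^2}\Big)$$ in $L^2(\mathbb R^2_+)$ with domain $C_c^\infty(\mathbb R^2_+)$. On $C^\infty_c(\mathbb R^2_+)$ put $$\mathfrak d_1^{\circ,\dagger}=-\frac{\partial}{\partial r}-\frac{\alpha+1/2}{r},\qquad \mathfrak d_2^{\circ,\dagger}=r\Big(-\frac{\partial}{\partial s}-\frac{\beta+1/2}{s}\Big).$$ For $f\in L^1_{\rm loc}(\mathbb R^2_+)$ and $j\in\{1,2\}$, a function $g_j\in L^1_{\rm loc}(\mathbb R^2_+)$ is the weak derivative $\mathfrak d^\circ_{j,\rm weak}f$ if $\int_{\mathbb R^2_+}\mathfrak d_j^{\circ,\dagger}\varphi\,\overline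 f\,dr\,ds=\int_{\mathbb R^2_+}\varphi\,\overline{g_j}\,dr\,ds$ for all $\varphi\in C_c^\infty(\mathbb R^2_+)$. Let $W^\circ_{\alpha,\beta}(\mathbb R^2_+)$ be the space of all $f\in L^2(\mathbb R^2_+)$ for which $\mathfrak d^\circ_{1,\rm weak}f$ and $\mathfrak d^\circ_{2,\rm weak}f$ exist and belong to $L^2(\mathbb R^2_+)$, with inner product $\langle f,g\rangle+\sum_{j=1}^2\langle \mathfrak d^\circ_{j,\rm weak}f,\mathfrak d^\circ_{j,\rm weak}g\rangle$, and let $W^\circ_{0;\alpha,\beta}(\mathbb R^2_+)$ be the closure of $C_c^\infty(\mathbb R^2_+)$ in it. Let $\mathfrak t^\circ$ be the form with domain $W^\circ_{\alpha,\beta}(\mathbb R^2_+)$, $$\mathfrak t^\circ[f,g]=\int_{\mathbb R^2_+}\sum_{j=1}^2\mathfrak d^\circ_{j,\rm weak}f\;\overline{\mathfrak d^\circ_{j,\rm weak}g}\,dr\,ds,$$ and let $\mathfrak t_0^\circ$ be its restriction to $W^\circ_{0;\alpha,\beta}(\mathbb R^2_+)$. For a densely defined form $\mathfrak s$ with domain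 $\mathcal D(\mathfrak s)$ in a Hilbert space $H$, the associated operator $A_{\mathfrak s}$ has as its domain all $h\in \mathcal D(\mathfrak s)$ for which there is $u_h\in H$ with $\mathfrak s[h,h']=\langle u_h,h'\rangle$ for all $h'\in \mathcal D(\mathfrak s)$, and $A_{\mathfrak s}h=u_h$. A nonnegative form is closed if its domain is complete in the norm $(\mathfrak s[h,h]+\|h\|^2)^{1/2}$. The Friedrichs extension of a densely defined, symmetric, nonnegative operator $S$ is the operator associated with the closure of the form $\langle Sx,y\rangle$ on $\mathcal D(S)$, the closure being the closed Hermitian nonnegative form in $H$ that extends this form and in whose domain $\mathcal D(S)$ is dense for the form norm. Let $\mathbb D^\circ_{\alpha,\beta}$ and $\mathbb D^\circ_{0;\alpha,\beta}$ be the operators associated with $\mathfrak t^\circ$ and $\mathfrak t^\circ_0$. **Theorem.** For $\alpha,\beta>-1$ the forms $\mathfrak t^\circ$ and $\mathfrak t_0^\circ$ are densely defined, Hermitian, nonnegative and closed, and the operators $\mathbb D^\circ_{\alpha,\beta}$ and $\mathbb D^\circ_{0;\alpha,\beta}$ are self-adjoint nonnegative extensions of $G^\circ_{\alpha,\beta}$.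 Moreover, $G^\circ_{\alpha,\beta}$ is densely defined, symmetric and nonnegative, and $\mathbb D^\circ_{0;\alpha,\beta}$ is its Friedrichs extension. -/

import Mathlib

open MeasureTheory Filter Topology
open scoped ContDiff ComplexConjugate

noncomputable section

namespace Grushin

/-! ### Sesquilinear forms and their associated operators on a Hilbert space -/

section Forms

variable {H : Type*} [NormedAddCommGroup H] [InnerProductSpace ℂ H]

variable (H) in
/-- A sesquilinear form on a linear subspace of `H`: linear in the first variable and
conjugate-linear in the second one. -/
structure SesqForm where
  domain : Submodule ℂ H
  toFun : domain →ₗ[ℂ] domain →ₗ⋆[ℂ] ℂ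

namespace SesqForm

def IsDenselyDefined (s : SesqForm H) : Prop := Dense (s.domain : Set H)

def IsHermitian (s : SesqForm H) : Prop :=
  ∀ x y : s.domain, s.toFun x y = conj (s.toFun y x)

def IsNonneg (s : SesqForm H) : Prop :=
  ∀ x : s.domain, 0 ≤ (s.toFun x x).re ∧ (s.toFun x x).im = 0

/-- The form norm `(s[h, h] + ‖h‖²)^{1/2}` of a nonnegative form. -/
def formNorm (s : SesqForm H) (h : s.domain) : ℝ :=
  Real.sqrt ((s.toFun h h).re + ‖(h : H)‖ ^ 2)

/-- Closedness of a nonnegative form: its domain is complete in the form norm. -/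
def IsClosed (s : SesqForm H) : Prop :=
  ∀ u : ℕ → s.domain,
    (∀ ε : ℝ, 0 < ε → ∃ N : ℕ, ∀ m n : ℕ, N ≤ m → N ≤ n → s.formNorm (u m - u n) < ε) →
    ∃ h : s.domain, Tendsto (fun n => s.formNorm (u n - h)) atTop (𝓝 0)

/-- `t` extends `s`. -/
def Extends (t s : SesqForm H) : Prop :=
  ∃ hle : s.domain ≤ t.domain, ∀ x y : s.domain,
    t.toFun (Submodule.inclusion hle x) (Submodule.inclusion hle y) = s.toFun x y

/-- `t` is the closure of the Hermitian nonnegative form `s`, that is, the completion of `s` in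
the form norm realized inside `H`: a closed Hermitian nonnegative form extending `s`, in whose
domain the domain of `s` is dense for the form norm. -/
def IsClosureOf (t s : SesqForm H) : Prop :=
  t.IsHermitian ∧ t.IsNonneg ∧ t.IsClosed ∧ t.Extends s ∧
    ∀ h : t.domain, ∃ u : ℕ → t.domain,
      (∀ n, (u n : H) ∈ s.domain) ∧ Tendsto (fun n => t.formNorm (u n - h)) atTop (𝓝 0)

/-- The form `s` restricted to a smaller subspace. -/
def restrict (s : SesqForm H) (K : Submodule ℂ H) (hK : K ≤ s.domain) : SesqForm H where
  domain := K
  toFun := LinearMap.mk₂'ₛₗ (RingHom.id ℂ) (starRingEnd ℂ)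
    (fun x y => s.toFun (Submodule.inclusion hK x) (Submodule.inclusion hK y))
    (by intros; simp) (by intros; simp) (by intros; simp) (by intros; simp)

/-- The graph of the operator associated with `s`: all `(h, u)` with `h` in the domain of `s` and
`s[h, h'] = ⟨u, h'⟩` for all `h'` in the domain of `s`. (Mathlib's `inner ℂ x y` is
conjugate-linear in `x`, so that `⟨u, h'⟩`, linear in `u`, is `inner ℂ h' u`.) -/
def assocGraph (s : SesqForm H) : Submodule ℂ (H × H) where
  carrier := {p | ∃ hp : p.1 ∈ s.domain, ∀ h' : s.domain,
    s.toFun ⟨p.1, hp⟩ h' = inner ℂ (h' : H) p.2}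
  zero_mem' := by
    refine ⟨s.domain.zero_mem, fun h' => ?_⟩
    have : (⟨(0 : H × H).1, s.domain.zero_mem⟩ : s.domain) = 0 := rfl
    rw [this]
    simp
  add_mem' := by
    rintro p q ⟨hp, hp'⟩ ⟨hq, hq'⟩
    refine ⟨s.domain.add_mem hp hq, fun h' => ?_⟩
    have : (⟨(p + q).1, s.domain.add_mem hp hq⟩ : s.domain) = ⟨p.1, hp⟩ + ⟨q.1, hq⟩ := rfl
    rw [this, map_add, LinearMap.add_apply, hp', hq', Prod.snd_add, inner_add_right]
  smul_mem' := by
    rintro c p ⟨hp, hp'⟩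
    refine ⟨s.domain.smul_mem c hp, fun h' => ?_⟩
    have : (⟨(c • p).1, s.domain.smul_mem c hp⟩ : s.domain) = c • ⟨p.1, hp⟩ := rfl
    rw [this, map_smul, LinearMap.smul_apply, hp', Prod.smul_snd, inner_smul_right, smul_eq_mul]

/-- The operator associated with the (densely defined) form `s`. -/
def assocOp (s : SesqForm H) : H →ₗ.[ℂ] H := s.assocGraph.toLinearPMap

/-- For a densely defined form, `assocGraph` is the graph of `assocOp`. -/
theorem assocOp_graph (s : SesqForm H) (hs : s.IsDenselyDefined) :
    s.assocOp.graph = s.assocGraph := by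
  refine Submodule.toLinearPMap_graph_eq _ ?_
  rintro ⟨x, u⟩ ⟨hx, h⟩ (rfl : x = 0)
  refine hs.eq_zero_of_inner_right (𝕜 := ℂ) fun v hv => ?_
  have h1 := h ⟨v, hv⟩
  have h0 : (⟨((0 : H), u).1, hx⟩ : s.domain) = 0 := rfl
  rw [h0] at h1
  simpa using h1.symm

/-- The form `s_S[x, y] = ⟨S x, y⟩` on the domain of `S`. -/
def ofOperator (S : H →ₗ.[ℂ] H) : SesqForm H where
  domain := S.domain
  toFun := LinearMap.mk₂'ₛₗ (RingHom.id ℂ) (starRingEnd ℂ)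
    (fun x y => inner ℂ (y : H) (S x))
    (by intros; simp [LinearPMap.map_add])
    (by intros; simp [LinearPMap.map_smul])
    (by intros; simp)
    (by intros; simp [mul_comm])

end SesqForm

/-- Nonnegativity of an operator: `⟨S x, x⟩ ≥ 0` on its domain. -/
def IsNonnegOp (S : H →ₗ.[ℂ] H) : Prop :=
  ∀ x : S.domain, 0 ≤ (inner ℂ (x : H) (S x)).re ∧ (inner ℂ (x : H) (S x)).im = 0

/-- `A` is the Friedrichs extension of `S`: `S` is densely defined, symmetric and nonnegative,
and `A` is the operator associated with the closure of the form `⟨S x, y⟩`. -/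
def IsFriedrichsExtension (S A : H →ₗ.[ℂ] H) : Prop :=
  Dense (S.domain : Set H) ∧ S.IsFormalAdjoint S ∧ IsNonnegOp S ∧
    ∃ t : SesqForm H, t.IsClosureOf (SesqForm.ofOperator S) ∧ A = t.assocOp

end Forms

/-! ### Test functions and differential operators on the open quadrant -/

/-- The open quadrant `(0, ∞) × (0, ∞)`. -/
def quadrant : TopologicalSpace.Opens (ℝ × ℝ) :=
  ⟨Set.Ioi 0 ×ˢ Set.Ioi 0, isOpen_Ioi.prod isOpen_Ioi⟩

/-- Lebesgue measure on the quadrant. -/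
def quadMeasure : Measure (ℝ × ℝ) := volume.restrict (quadrant : Set (ℝ × ℝ))

/-- The Hilbert space `L²` of the quadrant. -/
abbrev L2 : Type := Lp ℂ 2 quadMeasure

/-- Complex-valued smooth functions with compact support in the quadrant. -/
abbrev TestFn : Type := TestFunction quadrant ℂ ⊤

/-- The partial derivative in the direction `v`. -/
def pd (v : ℝ × ℝ) : TestFn →ₗ[ℂ] TestFn where
  toFun φ :=
    { toFun := fun p => fderiv ℝ φ p v
      contDiff' := by
        have h : ContDiff ℝ ∞ (φ : ℝ × ℝ → ℂ) := φ.contDiff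
        exact (h.fderiv_right (m := ∞) (by simp)).clm_apply contDiff_const
      hasCompactSupport' := φ.hasCompactSupport.fderiv_apply (𝕜 := ℝ) v
      tsupport_subset' := (tsupport_fderiv_apply_subset ℝ v).trans φ.tsupport_subset }
  map_add' φ ψ := by
    ext p
    have h1 : DifferentiableAt ℝ (φ : ℝ × ℝ → ℂ) p :=
      (φ.contDiff.differentiable (by simp)).differentiableAt
    have h2 : DifferentiableAt ℝ (ψ : ℝ × ℝ → ℂ) p :=
      (ψ.contDiff.differentiable (by simp)).differentiableAt
    change fderiv ℝ (fun q => φ q + ψ q) p v = fderiv ℝ φ p v + fderiv ℝ ψ p v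
    rw [fderiv_fun_add h1 h2]
    rfl
  map_smul' c φ := by
    ext p
    have h1 : DifferentiableAt ℝ (φ : ℝ × ℝ → ℂ) p :=
      (φ.contDiff.differentiable (by simp)).differentiableAt
    change fderiv ℝ (fun q => c • φ q) p v = c • fderiv ℝ φ p v
    rw [fderiv_fun_const_smul h1]
    rfl

/-- Multiplication by a real function that is smooth on the quadrant. -/
def mulBy (c : ℝ × ℝ → ℝ) (hc : ContDiffOn ℝ ∞ c quadrant) : TestFn →ₗ[ℂ] TestFn where
  toFun φ :=
    { toFun := fun p => (c p : ℂ) * φ p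
      contDiff' := by
        refine contDiff_iff_contDiffAt.2 fun p => ?_
        by_cases hp : p ∈ tsupport (φ : ℝ × ℝ → ℂ)
        · have hp' : p ∈ (quadrant : Set (ℝ × ℝ)) := φ.tsupport_subset hp
          have h1 : ContDiffAt ℝ ∞ c p := (hc p hp').contDiffAt (quadrant.isOpen.mem_nhds hp')
          have h2 : ContDiffAt ℝ ∞ (fun q => (c q : ℂ)) p :=
            Complex.ofRealCLM.contDiff.contDiffAt.comp p h1
          exact h2.mul φ.contDiff.contDiffAt
        · refine (contDiffAt_const (c := (0 : ℂ))).congr_of_eventuallyEq ?_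
          filter_upwards [notMem_tsupport_iff_eventuallyEq.1 hp] with q hq
          simp [hq]
      hasCompactSupport' := φ.hasCompactSupport.mul_left
      tsupport_subset' := tsupport_mul_subset_right.trans φ.tsupport_subset }
  map_add' φ ψ := by
    ext p
    exact mul_add _ _ _
  map_smul' a φ := by
    ext p
    exact mul_left_comm _ _ _

theorem contDiffOn_div_fst (c : ℝ) (k : ℕ) :
    ContDiffOn ℝ ∞ (fun p : ℝ × ℝ => c / p.1 ^ k) quadrant :=
  contDiffOn_const.div (contDiff_fst.pow k).contDiffOn fun _ hp => pow_ne_zero k (ne_of_gt hp.1)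

theorem contDiffOn_div_snd (c : ℝ) (k : ℕ) :
    ContDiffOn ℝ ∞ (fun p : ℝ × ℝ => c / p.2 ^ k) quadrant :=
  contDiffOn_const.div (contDiff_snd.pow k).contDiffOn fun _ hp => pow_ne_zero k (ne_of_gt hp.2)

theorem contDiffOn_pow_fst (k : ℕ) :
    ContDiffOn ℝ ∞ (fun p : ℝ × ℝ => p.1 ^ k) quadrant :=
  (contDiff_fst.pow k).contDiffOn

/-- `∂/∂r` on test functions of `(r, s)`. -/
def dr : TestFn →ₗ[ℂ] TestFn := pd (1, 0)

/-- `∂/∂s` on test functions of `(r, s)`. -/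
def ds : TestFn →ₗ[ℂ] TestFn := pd (0, 1)

/-- The differential expression
`(-∂²/∂r² + (α² - 1/4) / r²) + r² (-∂²/∂s² + (β² - 1/4) / s²)` on test functions. -/
def grushinExpr (α β : ℝ) : TestFn →ₗ[ℂ] TestFn :=
  (-(dr ∘ₗ dr) + mulBy (fun p => (α ^ 2 - 1 / 4) / p.1 ^ 2) (contDiffOn_div_fst _ 2)) +
    mulBy (fun p => p.1 ^ 2) (contDiffOn_pow_fst 2) ∘ₗ
      (-(ds ∘ₗ ds) + mulBy (fun p => (β ^ 2 - 1 / 4) / p.2 ^ 2) (contDiffOn_div_snd _ 2))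

/-- The formal adjoints of the two partial delta-derivatives:
`-∂/∂r - (α + 1/2) / r` for `j = 0` and `r (-∂/∂s - (β + 1/2) / s)` for `j = 1`. -/
def deltaDag (α β : ℝ) : Fin 2 → (TestFn →ₗ[ℂ] TestFn)
  | 0 => -dr - mulBy (fun p => (α + 1 / 2) / p.1 ^ 1) (contDiffOn_div_fst _ 1)
  | 1 => mulBy (fun p => p.1 ^ 1) (contDiffOn_pow_fst 1) ∘ₗ
      (-ds - mulBy (fun p => (β + 1 / 2) / p.2 ^ 1) (contDiffOn_div_snd _ 1))

theorem testFn_memLp (φ : TestFn) : MemLp (φ : ℝ × ℝ → ℂ) 2 quadMeasure :=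
  (φ.continuous.memLp_of_hasCompactSupport φ.hasCompactSupport).restrict _

/-- The `L²` class of a test function. -/
def toL2 : TestFn →ₗ[ℂ] L2 where
  toFun φ := (testFn_memLp φ).toLp φ
  map_add' φ ψ := MemLp.toLp_add (testFn_memLp φ) (testFn_memLp ψ)
  map_smul' c φ := MemLp.toLp_const_smul c (testFn_memLp φ)

theorem toL2_ae (φ : TestFn) : toL2 φ =ᵐ[quadMeasure] φ :=
  MemLp.coeFn_toLp (testFn_memLp φ)

theorem toL2_injective : Function.Injective toL2 := by
  intro φ ψ h
  have h1 : (φ : ℝ × ℝ → ℂ) =ᵐ[quadMeasure] ψ :=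
    (toL2_ae φ).symm.trans ((by rw [h] : toL2 φ =ᵐ[quadMeasure] toL2 ψ).trans (toL2_ae ψ))
  have h2 : Set.EqOn (φ : ℝ × ℝ → ℂ) ψ quadrant :=
    Measure.eqOn_open_of_ae_eq h1 quadrant.isOpen φ.continuous.continuousOn
      ψ.continuous.continuousOn
  ext p
  by_cases hp : p ∈ (quadrant : Set (ℝ × ℝ))
  · exact h2 hp
  · rw [image_eq_zero_of_notMem_tsupport fun h' => hp (φ.tsupport_subset h'),
      image_eq_zero_of_notMem_tsupport fun h' => hp (ψ.tsupport_subset h')]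

/-- The operator `G°` in `L²`, with domain the test functions. -/
def grushinOp (α β : ℝ) : L2 →ₗ.[ℂ] L2 where
  domain := LinearMap.range toL2
  toFun := (toL2 ∘ₗ grushinExpr α β) ∘ₗ
    (LinearEquiv.ofInjective toL2 toL2_injective).symm.toLinearMap

/-! ### Weak delta-derivatives and the delta-Sobolev spaces -/

/-- `g` is the weak `j`-th partial delta-derivative of `f` on the quadrant. -/
def IsWeakDelta (α β : ℝ) (j : Fin 2) (f g : ℝ × ℝ → ℂ) : Prop :=
  LocallyIntegrableOn f (quadrant : Set (ℝ × ℝ)) ∧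
  LocallyIntegrableOn g (quadrant : Set (ℝ × ℝ)) ∧
  ∀ φ : TestFn, ∫ p in (quadrant : Set (ℝ × ℝ)), deltaDag α β j φ p * conj (f p) =
    ∫ p in (quadrant : Set (ℝ × ℝ)), φ p * conj (g p)

theorem L2_locallyIntegrableOn (f : L2) :
    LocallyIntegrableOn (f : ℝ × ℝ → ℂ) (quadrant : Set (ℝ × ℝ)) := by
  have : IsLocallyFiniteMeasure quadMeasure := by unfold quadMeasure; infer_instance
  exact locallyIntegrableOn_of_locallyIntegrable_restrict
    ((Lp.memLp f).locallyIntegrable (by norm_num))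

theorem integral_mul_conj (f : L2) (φ : TestFn) :
    ∫ p in (quadrant : Set (ℝ × ℝ)), φ p * conj ((f : ℝ × ℝ → ℂ) p) = inner ℂ f (toL2 φ) := by
  rw [L2.inner_def]
  refine integral_congr_ae ?_
  filter_upwards [toL2_ae φ] with p hp
  rw [hp]
  exact (RCLike.inner_apply _ _).symm

theorem isWeakDelta_iff (α β : ℝ) (j : Fin 2) (f g : L2) :
    IsWeakDelta α β j f g ↔
      ∀ φ : TestFn, inner ℂ f (toL2 (deltaDag α β j φ)) = inner ℂ g (toL2 φ) := by
  simp only [IsWeakDelta, integral_mul_conj, L2_locallyIntegrableOn, true_and]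

/-- An `L²` function orthogonal to all test functions vanishes. -/
theorem eq_zero_of_inner_toL2 (g : L2) (h : ∀ φ : TestFn, inner ℂ g (toL2 φ) = 0) : g = 0 := by
  have key : ∀ᵐ p ∂volume, p ∈ (quadrant : Set (ℝ × ℝ)) → conj ((g : ℝ × ℝ → ℂ) p) = 0 := by
    refine quadrant.isOpen.ae_eq_zero_of_integral_contDiff_smul_eq_zero ?_ ?_
    · intro p hp
      obtain ⟨s, hs, hi⟩ := L2_locallyIntegrableOn g p hp
      exact ⟨s, hs, (Complex.conjCLE.toContinuousLinearMap).integrable_comp hi⟩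
    · intro ψ hψ hc hs
      let φ : TestFn :=
        { toFun := fun p => (ψ p : ℂ)
          contDiff' := Complex.ofRealCLM.contDiff.comp hψ
          hasCompactSupport' := hc.comp_left (g := fun x : ℝ => (x : ℂ)) Complex.ofReal_zero
          tsupport_subset' := (tsupport_comp_subset (g := fun x : ℝ => (x : ℂ))
            Complex.ofReal_zero ψ).trans hs }
      have h1 := h φ
      rw [← integral_mul_conj] at h1
      rw [← h1, ← setIntegral_eq_integral_of_forall_compl_eq_zero
        (s := (quadrant : Set (ℝ × ℝ)))]
      · rfl
      · intro p hp
        rw [image_eq_zero_of_notMem_tsupport fun h' => hp (hs h'), zero_smul]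
  refine Lp.ext ?_
  have h2 : ∀ᵐ p ∂quadMeasure, conj ((g : ℝ × ℝ → ℂ) p) = 0 :=
    (ae_restrict_iff' quadrant.isOpen.measurableSet).2 key
  filter_upwards [h2, Lp.coeFn_zero ℂ 2 quadMeasure] with p hp h0
  rw [h0]
  simpa using hp

theorem IsWeakDelta.unique {α β : ℝ} {j : Fin 2} {f g₁ g₂ : L2}
    (h₁ : IsWeakDelta α β j f g₁) (h₂ : IsWeakDelta α β j f g₂) : g₁ = g₂ := by
  rw [isWeakDelta_iff] at h₁ h₂
  refine sub_eq_zero.1 (eq_zero_of_inner_toL2 _ fun φ => ?_)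
  rw [inner_sub_left, ← h₁, ← h₂, sub_self]

theorem IsWeakDelta.add {α β : ℝ} {j : Fin 2} {f₁ f₂ g₁ g₂ : L2}
    (h₁ : IsWeakDelta α β j f₁ g₁) (h₂ : IsWeakDelta α β j f₂ g₂) :
    IsWeakDelta α β j (f₁ + f₂ : L2) (g₁ + g₂ : L2) := by
  rw [isWeakDelta_iff] at *
  intro φ
  rw [inner_add_left, inner_add_left, h₁, h₂]

theorem IsWeakDelta.smul {α β : ℝ} {j : Fin 2} {f g : L2} (c : ℂ)
    (h : IsWeakDelta α β j f g) : IsWeakDelta α β j (c • f : L2) (c • g : L2) := by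
  rw [isWeakDelta_iff] at *
  intro φ
  rw [inner_smul_left, inner_smul_left, h]

/-- The delta-Sobolev space: `L²` functions whose two weak partial delta-derivatives exist and
are in `L²`. -/
def deltaSobolev (α β : ℝ) : Submodule ℂ L2 where
  carrier := {f | ∀ j : Fin 2, ∃ g : L2, IsWeakDelta α β j f g}
  zero_mem' j := ⟨0, (isWeakDelta_iff α β j 0 0).2 fun φ => by simp⟩
  add_mem' hf hg j := by
    obtain ⟨f', hf'⟩ := hf j
    obtain ⟨g', hg'⟩ := hg j
    exact ⟨f' + g', hf'.add hg'⟩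
  smul_mem' c f hf j := by
    obtain ⟨f', hf'⟩ := hf j
    exact ⟨c • f', hf'.smul c⟩

/-- The weak `j`-th partial delta-derivative on the delta-Sobolev space. -/
def weakDelta (α β : ℝ) (j : Fin 2) : deltaSobolev α β →ₗ[ℂ] L2 where
  toFun f := (f.2 j).choose
  map_add' f g := ((f + g).2 j).choose_spec.unique ((f.2 j).choose_spec.add (g.2 j).choose_spec)
  map_smul' c f := ((c • f).2 j).choose_spec.unique ((f.2 j).choose_spec.smul c)

theorem weakDelta_spec (α β : ℝ) (j : Fin 2) (f : deltaSobolev α β) :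
    IsWeakDelta α β j (f : L2) (weakDelta α β j f) := (f.2 j).choose_spec

/-- The inner product of the delta-Sobolev space, linear in `f`. -/
def sobolevInner (α β : ℝ) (f g : deltaSobolev α β) : ℂ :=
  inner ℂ (g : L2) (f : L2) + ∑ j : Fin 2, inner ℂ (weakDelta α β j g) (weakDelta α β j f)

/-- The norm of the delta-Sobolev space. -/
def sobolevNorm (α β : ℝ) (f : deltaSobolev α β) : ℝ :=
  Real.sqrt (sobolevInner α β f f).re

/-- A function together with its weak partial delta-derivatives. -/
def sobolevEmbed (α β : ℝ) :
    deltaSobolev α β →ₗ[ℂ] WithLp 2 (L2 × PiLp 2 fun _ : Fin 2 => L2) where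
  toFun f := WithLp.toLp 2 ((f : L2), WithLp.toLp 2 fun j : Fin 2 => weakDelta α β j f)
  map_add' f g := by
    simp only [map_add]
    rfl
  map_smul' c f := by
    simp only [map_smul]
    rfl

theorem sobolevNorm_eq (α β : ℝ) (f : deltaSobolev α β) :
    sobolevNorm α β f = ‖sobolevEmbed α β f‖ := by
  rw [@norm_eq_sqrt_re_inner ℂ, sobolevNorm]
  rfl

theorem sobolevNorm_add_le (α β : ℝ) (f g : deltaSobolev α β) :
    sobolevNorm α β (f + g) ≤ sobolevNorm α β f + sobolevNorm α β g := by
  simp only [sobolevNorm_eq, map_add]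
  exact norm_add_le _ _

theorem sobolevNorm_smul (α β : ℝ) (c : ℂ) (f : deltaSobolev α β) :
    sobolevNorm α β (c • f) = ‖c‖ * sobolevNorm α β f := by
  simp only [sobolevNorm_eq, map_smul, norm_smul]

/-- The closure of the test functions in the delta-Sobolev space. -/
def deltaSobolevZero (α β : ℝ) : Submodule ℂ L2 where
  carrier := {f | ∃ hf : f ∈ deltaSobolev α β, ∃ u : ℕ → deltaSobolev α β,
    (∀ n, ∃ φ : TestFn, (u n : L2) = toL2 φ) ∧
    Tendsto (fun n => sobolevNorm α β (u n - ⟨f, hf⟩)) atTop (𝓝 0)}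
  zero_mem' := by
    refine ⟨Submodule.zero_mem _, fun _ => 0, fun _ => ⟨0, by simp⟩, ?_⟩
    have h0 : (⟨0, Submodule.zero_mem _⟩ : deltaSobolev α β) = 0 := rfl
    simp [h0, sobolevNorm_eq]
  add_mem' := by
    rintro f g ⟨hf, u, hu, huf⟩ ⟨hg, v, hv, hvg⟩
    refine ⟨Submodule.add_mem _ hf hg, fun n => u n + v n, fun n => ?_, ?_⟩
    · obtain ⟨φ, hφ⟩ := hu n
      obtain ⟨ψ, hψ⟩ := hv n
      exact ⟨φ + ψ, by rw [map_add, ← hφ, ← hψ]; rfl⟩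
    · refine squeeze_zero (fun n => Real.sqrt_nonneg _) (fun n => ?_)
        (by simpa using huf.add hvg)
      have h : u n + v n - ⟨f + g, Submodule.add_mem _ hf hg⟩ =
          (u n - ⟨f, hf⟩) + (v n - ⟨g, hg⟩) := add_sub_add_comm (u n) (v n) ⟨f, hf⟩ ⟨g, hg⟩
      rw [h]
      exact sobolevNorm_add_le α β _ _
  smul_mem' := by
    rintro c f ⟨hf, u, hu, huf⟩
    refine ⟨Submodule.smul_mem _ c hf, fun n => c • u n, fun n => ?_, ?_⟩
    · obtain ⟨φ, hφ⟩ := hu n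
      exact ⟨c • φ, by rw [map_smul, ← hφ]; rfl⟩
    · have h : ∀ n, c • u n - ⟨c • f, Submodule.smul_mem _ c hf⟩ = c • (u n - ⟨f, hf⟩) :=
        fun n => (smul_sub c (u n) ⟨f, hf⟩).symm
      simp only [h, sobolevNorm_smul]
      simpa using huf.const_mul ‖c‖

theorem deltaSobolevZero_le (α β : ℝ) : deltaSobolevZero α β ≤ deltaSobolev α β :=
  fun _ hf => hf.1

theorem integral_weakDelta (α β : ℝ) (f g : deltaSobolev α β) :
    ∫ p in (quadrant : Set (ℝ × ℝ)), ∑ j : Fin 2,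
        (weakDelta α β j f : ℝ × ℝ → ℂ) p * conj ((weakDelta α β j g : ℝ × ℝ → ℂ) p) =
      ∑ j : Fin 2, inner ℂ (weakDelta α β j g) (weakDelta α β j f) := by
  simp only [L2.inner_def]
  rw [← integral_finsetSum _ fun j _ => L2.integrable_inner (𝕜 := ℂ) _ _]
  refine integral_congr_ae (Eventually.of_forall fun p => ?_)
  exact Finset.sum_congr rfl fun j _ => (RCLike.inner_apply _ _).symm

/-- The form `𝔱°[f, g] = ∫ ∑ⱼ (δⱼ f) (conj (δⱼ g))` on the delta-Sobolev space. -/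
def formT (α β : ℝ) : SesqForm L2 where
  domain := deltaSobolev α β
  toFun := LinearMap.mk₂'ₛₗ (RingHom.id ℂ) (starRingEnd ℂ)
    (fun f g => ∫ p in (quadrant : Set (ℝ × ℝ)), ∑ j : Fin 2,
      (weakDelta α β j f : ℝ × ℝ → ℂ) p * conj ((weakDelta α β j g : ℝ × ℝ → ℂ) p))
    (by
      intro f₁ f₂ g
      rw [integral_weakDelta, integral_weakDelta, integral_weakDelta]
      simp only [map_add, inner_add_right, Finset.sum_add_distrib])
    (by
      intro c f g
      rw [integral_weakDelta, integral_weakDelta]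
      simp only [map_smul, inner_smul_right, Finset.mul_sum, smul_eq_mul,
        RingHom.id_apply])
    (by
      intro f g₁ g₂
      rw [integral_weakDelta, integral_weakDelta, integral_weakDelta]
      simp only [map_add, inner_add_left, Finset.sum_add_distrib])
    (by
      intro c f g
      rw [integral_weakDelta, integral_weakDelta]
      simp only [map_smul, inner_smul_left, Finset.mul_sum, smul_eq_mul])

/-- The restriction of `𝔱°` to the closure of the test functions. -/
def formTZero (α β : ℝ) : SesqForm L2 :=
  (formT α β).restrict (deltaSobolevZero α β) (deltaSobolevZero_le α β)

/-- The operator associated with `𝔱°`. -/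
def opD (α β : ℝ) : L2 →ₗ.[ℂ] L2 := (formT α β).assocOp

/-- The operator associated with the restricted form. -/
def opDZero (α β : ℝ) : L2 →ₗ.[ℂ] L2 := (formTZero α β).assocOp

end Grushin

end

/-! Two independent facts carry the theorem.

Abstract: the domain of a closed nonnegative Hermitian form `s` is a Hilbert space for `s[x, y] +
⟨x, y⟩`, and its norm dominates that of `H`. Riesz representation of `v ↦ ⟨v, x⟩` on it therefore
solves `A w + w = x` for every `x` (`IsClosed.exists_mem_assocGraph`). A symmetric `A` with `A + 1`
onto is self-adjoint as soon as its domain is dense, and density follows from the same solvability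
(`IsClosed.isSelfAdjoint_assocOp`).

Concrete: on test functions the Grushin expression factors as `∑ⱼ δⱼ† δⱼ` (`sum_deltaDag_delta`),
and integration by parts makes `δⱼ` the weak derivative. The definition of weak derivative then
gives `𝔱°[φ, g] = ⟨G° φ, g⟩` for every test function `φ` and every `g` in the Sobolev space
(`formT_toL2`); this yields the extension claims and the symmetry and nonnegativity of `G°`. The
form norm is the Sobolev norm, and weak derivatives pass to `L²` limits, so `𝔱°` is closed; `𝔱₀°`
lives on a closed subspace in which test functions are dense, so it is the closure of the form of
`G°`. -/

namespace Grushin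

/-! ### Operators associated with closed nonnegative forms -/

namespace SesqForm

variable {H : Type*} [NormedAddCommGroup H] [InnerProductSpace ℂ H]

theorem mem_assocGraph {s : SesqForm H} {x u : H} :
    (x, u) ∈ s.assocGraph ↔
      ∃ hx : x ∈ s.domain, ∀ y : s.domain, s.toFun ⟨x, hx⟩ y = inner ℂ (y : H) u :=
  Iff.rfl

theorem assocOp_mem_assocGraph {s : SesqForm H} (hs : s.IsDenselyDefined)
    (x : s.assocOp.domain) : ((x : H), s.assocOp x) ∈ s.assocGraph :=
  assocOp_graph s hs ▸ s.assocOp.mem_graph x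

theorem exists_assocOp_eq {s : SesqForm H} (hs : s.IsDenselyDefined) {x u : H}
    (h : (x, u) ∈ s.assocGraph) : ∃ y : s.assocOp.domain, (y : H) = x ∧ s.assocOp y = u := by
  rw [← assocOp_graph s hs] at h
  simpa using LinearPMap.mem_graph_iff _ |>.1 h

theorem IsNonneg.assocOp {s : SesqForm H} (hn : s.IsNonneg) (hs : s.IsDenselyDefined) :
    IsNonnegOp s.assocOp := by
  intro x
  obtain ⟨hx, h⟩ := mem_assocGraph.1 (assocOp_mem_assocGraph hs x)
  have h' := h ⟨x, hx⟩
  exact h' ▸ hn ⟨x, hx⟩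

theorem IsHermitian.assocOp_isFormalAdjoint {s : SesqForm H} (hh : s.IsHermitian)
    (hs : s.IsDenselyDefined) : s.assocOp.IsFormalAdjoint s.assocOp := by
  intro x y
  obtain ⟨hx, h⟩ := mem_assocGraph.1 (assocOp_mem_assocGraph hs x)
  obtain ⟨hy, h'⟩ := mem_assocGraph.1 (assocOp_mem_assocGraph hs y)
  rw [← inner_conj_symm, ← h' ⟨x, hx⟩, ← h ⟨y, hy⟩, ← hh]

/-- The domain of a form, to be equipped with the inner product of the form. -/
def FormSpace (s : SesqForm H) : Type _ := s.domain

/-- Only the algebraic structure is inherited: the norm of `H` is left behind so that the form norm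
can take its place. -/
noncomputable instance (s : SesqForm H) : AddCommGroup s.FormSpace :=
  inferInstanceAs (AddCommGroup s.domain)

noncomputable instance (s : SesqForm H) : Module ℂ s.FormSpace :=
  inferInstanceAs (Module ℂ s.domain)

/-- The inclusion of the form space in the ambient Hilbert space. -/
def FormSpace.incl (s : SesqForm H) : s.FormSpace →ₗ[ℂ] H := s.domain.subtype

/-- The inner product `s[y, x] + ⟨y, x⟩` on the domain of a nonnegative Hermitian form. -/
@[reducible]
noncomputable def formCore (s : SesqForm H) (hh : s.IsHermitian) (hn : s.IsNonneg) :
    InnerProductSpace.Core ℂ s.FormSpace where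
  -- The form is linear in its first slot and `inner` in its second, hence the swap.
  inner x y := s.toFun y x + inner ℂ (FormSpace.incl s x) (FormSpace.incl s y)
  conj_inner_symm x y := by
    rw [map_add, inner_conj_symm, ← hh y x]
  re_inner_nonneg x := by
    have h := (hn x).1
    have h' := inner_self_nonneg (𝕜 := ℂ) (x := FormSpace.incl s x)
    rw [map_add]
    exact add_nonneg h h'
  add_left x y z := by
    rw [map_add, inner_add_left]
    have : s.toFun z (x + y : s.FormSpace) = s.toFun z x + s.toFun z y := (s.toFun z).map_add x y
    rw [this]
    ring
  smul_left x y c := by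
    rw [map_smul, inner_smul_left]
    have : s.toFun y (c • x : s.FormSpace) = conj c * s.toFun y x :=
      (s.toFun y).map_smulₛₗ c x
    rw [this]
    ring
  definite x h := by
    have h1 := congrArg Complex.re h
    have h2 := (hn x).1
    have h3 : (inner ℂ (FormSpace.incl s x) (FormSpace.incl s x)).re = ‖FormSpace.incl s x‖ ^ 2 := by
      rw [inner_self_eq_norm_sq_to_K]
      norm_cast
    rw [Complex.add_re, h3, Complex.zero_re] at h1
    have h4 : FormSpace.incl s x = 0 := by
      rw [← norm_eq_zero]
      nlinarith [sq_nonneg ‖FormSpace.incl s x‖]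
    exact Subtype.ext h4

/-- The resolvent equation `A h + h = x` of the operator associated with a closed form. -/
theorem IsClosed.exists_mem_assocGraph [CompleteSpace H] {s : SesqForm H} (hc : s.IsClosed)
    (hh : s.IsHermitian) (hn : s.IsNonneg) (x : H) : ∃ w : H, (w, x - w) ∈ s.assocGraph := by
  let _ : NormedAddCommGroup s.FormSpace :=
    @InnerProductSpace.Core.toNormedAddCommGroup ℂ s.FormSpace _ _ _ (s.formCore hh hn)
  let _ : InnerProductSpace ℂ s.FormSpace := InnerProductSpace.ofCore (s.formCore hh hn).toCore
  have hinner (v w : s.FormSpace) : inner ℂ v w =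
    s.toFun w v + inner ℂ (FormSpace.incl s v) (FormSpace.incl s w) := rfl
  have hre (v : H) : (inner ℂ v v).re = ‖v‖ ^ 2 := by
    rw [inner_self_eq_norm_sq_to_K]
    norm_cast
  have hnorm (v : s.FormSpace) : ‖v‖ = s.formNorm v := by
    rw [norm_eq_sqrt_re_inner (𝕜 := ℂ), hinner, map_add]
    refine congrArg (fun t => Real.sqrt ((s.toFun v v).re + t)) ?_
    exact hre _
  -- Closedness of the form is exactly completeness for this norm.
  have : CompleteSpace s.FormSpace := by
    refine Metric.complete_of_cauchySeq_tendsto fun u hu => ?_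
    obtain ⟨h, hlim⟩ := hc u fun ε hε => by
      obtain ⟨N, hN⟩ := Metric.cauchySeq_iff.1 hu ε hε
      refine ⟨N, fun m n hm hn' => ?_⟩
      have := hN m hm n hn'
      rw [dist_eq_norm, hnorm] at this
      exact this
    refine ⟨h, tendsto_iff_norm_sub_tendsto_zero.2 ?_⟩
    simp only [hnorm]
    exact hlim
  have hle (v : s.FormSpace) : ‖FormSpace.incl s v‖ ≤ 1 * ‖v‖ := by
    rw [hnorm, one_mul]
    refine Real.le_sqrt_of_sq_le ?_
    exact le_add_of_nonneg_left (hn v).1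
  let L : s.FormSpace →L[ℂ] ℂ :=
    (innerSL ℂ x).comp ((FormSpace.incl s).mkContinuous 1 hle)
  -- Riesz: `s[w, v] + ⟨w, v⟩ = ⟨x, v⟩` for all `v` in the form domain, which rearranges to `A w = x
  -- - w`.
  let w : s.FormSpace := (InnerProductSpace.toDual ℂ s.FormSpace).symm L
  have hw (v : s.FormSpace) : inner ℂ w v = inner ℂ x (FormSpace.incl s v) :=
    InnerProductSpace.toDual_symm_apply
  refine ⟨FormSpace.incl s w, mem_assocGraph.2 ⟨w.2, fun v => ?_⟩⟩
  have h1 (v : s.FormSpace) : inner ℂ v w = inner ℂ (FormSpace.incl s v) x := by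
    rw [← inner_conj_symm, hw, inner_conj_symm]
  rw [inner_sub_right]
  exact eq_sub_of_add_eq (h1 v)

/-- For `y` orthogonal to the domain, solve `A w + w = y`. Since `⟨y, w⟩ = 0`, testing with `w`
gives `s[w, w] = -‖w‖²`, so `w = 0`. The equation then says that `y` is orthogonal to the dense form
domain. -/
theorem IsClosed.dense_assocOp_domain [CompleteSpace H] {s : SesqForm H} (hc : s.IsClosed)
    (hh : s.IsHermitian) (hn : s.IsNonneg) (hs : s.IsDenselyDefined) :
    Dense (s.assocOp.domain : Set H) := by
  rw [Submodule.dense_iff_topologicalClosure_eq_top,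
    Submodule.topologicalClosure_eq_top_iff, Submodule.eq_bot_iff]
  intro y hy
  obtain ⟨w, hw⟩ := hc.exists_mem_assocGraph hh hn y
  obtain ⟨z, hz, -⟩ := exists_assocOp_eq hs hw
  obtain ⟨hwd, hw⟩ := mem_assocGraph.1 hw
  have h0 : inner ℂ w y = 0 := Submodule.mem_orthogonal _ y |>.1 hy w (hz ▸ z.2)
  have h1 := congrArg Complex.re (hw ⟨w, hwd⟩)
  have h2 := (hn ⟨w, hwd⟩).1
  rw [inner_sub_right, h0, inner_self_eq_norm_sq_to_K, h1] at *
  have h3 : ‖w‖ ^ 2 ≤ 0 := by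
    have : ((0 : ℂ) - (‖w‖ : ℂ) ^ 2).re = -‖w‖ ^ 2 := by
      rw [Complex.sub_re, ← Complex.ofReal_pow, Complex.ofReal_re, Complex.zero_re, zero_sub]
    have h4 := this ▸ h2
    linarith
  have hw0 : w = 0 := by
    rw [← norm_eq_zero]
    nlinarith [sq_nonneg ‖w‖]
  subst hw0
  refine hs.eq_zero_of_inner_right (𝕜 := ℂ) fun v hv => ?_
  have h5 := hw ⟨v, hv⟩
  have h6 : (⟨(0 : H), hwd⟩ : s.domain) = 0 := rfl
  rw [h6, map_zero, sub_zero] at h5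
  exact h5.symm

/-- The operator associated with a densely defined closed nonnegative Hermitian form is
self-adjoint. -/
theorem IsClosed.isSelfAdjoint_assocOp [CompleteSpace H] {s : SesqForm H} (hc : s.IsClosed)
    (hh : s.IsHermitian) (hn : s.IsNonneg) (hs : s.IsDenselyDefined) :
    IsSelfAdjoint s.assocOp := by
  have hd := hc.dense_assocOp_domain hh hn hs
  have hsym := hh.assocOp_isFormalAdjoint hs
  have hle := hsym.le_adjoint hd
  rw [LinearPMap.isSelfAdjoint_def]
  refine (LinearPMap.eq_of_le_of_domain_eq hle (le_antisymm hle.1 fun z hz => ?_)).symm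
  -- Choose `w'` in the domain of `A` with `(A + 1) w' = (A* + 1) z`; the claim is `z = w'`.
  obtain ⟨w, hw⟩ := hc.exists_mem_assocGraph hh hn (s.assocOp.adjoint ⟨z, hz⟩ + z)
  obtain ⟨w', rfl, hw'⟩ := exists_assocOp_eq hs hw
  suffices hzw : z - w' = 0 from sub_eq_zero.1 hzw ▸ w'.2
  -- With `(A + 1) v' = z - w'`, moving `A + 1` across gives `‖z - w'‖² = ⟨(A* + 1) z - (A + 1) w',
  -- v'⟩ = 0`.
  obtain ⟨v, hv⟩ := hc.exists_mem_assocGraph hh hn (z - w')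
  obtain ⟨v', rfl, hv'⟩ := exists_assocOp_eq hs hv
  have h1 : inner ℂ (s.assocOp.adjoint ⟨z, hz⟩) (v' : H) = inner ℂ z (s.assocOp v') :=
    LinearPMap.adjoint_isFormalAdjoint hd ⟨z, hz⟩ v'
  have h2 : inner ℂ (s.assocOp w') (v' : H) = inner ℂ (w' : H) (s.assocOp v') := hsym w' v'
  rw [hw', inner_sub_left, inner_add_left, h1] at h2
  have h3 : z - w' = s.assocOp v' + v' := by rw [hv']; abel
  rw [← inner_self_eq_zero (𝕜 := ℂ)]
  nth_rewrite 2 [h3]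
  rw [inner_sub_left, inner_add_right, inner_add_right]
  linear_combination h2

end SesqForm

end Grushin

namespace Grushin

/-! ### Calculus of test functions -/

theorem TestFn.apply_eq_zero (φ : TestFn) {p : ℝ × ℝ} (hp : p ∉ quadrant) : φ p = 0 :=
  image_eq_zero_of_notMem_tsupport fun h => hp (φ.tsupport_subset h)

theorem TestFn.ext_quadrant {φ ψ : TestFn} (h : ∀ p ∈ quadrant, φ p = ψ p) : φ = ψ := by
  ext p
  by_cases hp : p ∈ quadrant
  · exact h p hp
  · rw [φ.apply_eq_zero hp, ψ.apply_eq_zero hp]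

theorem mulBy_apply {c : ℝ × ℝ → ℝ} (hc : ContDiffOn ℝ ∞ c quadrant) (φ : TestFn) (p : ℝ × ℝ) :
    mulBy c hc φ p = (c p : ℂ) * φ p :=
  rfl

theorem pd_mulBy_apply (v : ℝ × ℝ) {c : ℝ × ℝ → ℝ} (hc : ContDiffOn ℝ ∞ c quadrant) (φ : TestFn)
    {p : ℝ × ℝ} (hp : p ∈ quadrant) :
    pd v (mulBy c hc φ) p = c p * pd v φ p + (fderiv ℝ c p v : ℝ) * φ p := by
  have hc' : HasFDerivAt c (fderiv ℝ c p) p :=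
    ((hc p hp).contDiffAt (quadrant.isOpen.mem_nhds hp)).differentiableAt (by simp) |>.hasFDerivAt
  have hφ : HasFDerivAt (φ : ℝ × ℝ → ℂ) (fderiv ℝ φ p) p :=
    (φ.contDiff.differentiable (by simp)).differentiableAt.hasFDerivAt
  have h := (Complex.ofRealCLM.hasFDerivAt.comp p hc').mul hφ
  change fderiv ℝ (fun q => (c q : ℂ) * φ q) p v = _
  have h' : fderiv ℝ (fun q => (c q : ℂ) * φ q) p = _ := h.fderiv
  rw [h']
  simp only [Function.comp_apply, _root_.add_apply, _root_.smul_apply,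
    ContinuousLinearMap.comp_apply, smul_eq_mul, Complex.ofRealCLM_apply]
  rw [mul_comm (φ p)]
  rfl

/-- Test functions vanish off the quadrant, so the integral may run over the whole plane, where
integration by parts has no boundary terms. -/
theorem inner_toL2 (ψ φ : TestFn) :
    inner ℂ (toL2 ψ) (toL2 φ) = ∫ p, φ p * conj (ψ p) := by
  have h : ∫ p in (quadrant : Set (ℝ × ℝ)), φ p * conj (ψ p) = ∫ p, φ p * conj (ψ p) :=
    setIntegral_eq_integral_of_forall_compl_eq_zero fun p hp => by
      rw [φ.apply_eq_zero hp, zero_mul]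
  rw [← integral_mul_conj, ← h]
  refine integral_congr_ae ?_
  filter_upwards [toL2_ae ψ] with p hp
  rw [hp]

theorem inner_toL2_mulBy {c : ℝ × ℝ → ℝ} (hc : ContDiffOn ℝ ∞ c quadrant) (ψ φ : TestFn) :
    inner ℂ (toL2 ψ) (toL2 (mulBy c hc φ)) = inner ℂ (toL2 (mulBy c hc ψ)) (toL2 φ) := by
  simp only [inner_toL2, mulBy_apply, map_mul, Complex.conj_ofReal]
  exact integral_congr_ae (Eventually.of_forall fun p => by ring)

/-- Integration by parts for test functions. -/
theorem inner_toL2_pd (v : ℝ × ℝ) (ψ φ : TestFn) :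
    inner ℂ (toL2 ψ) (toL2 (pd v φ)) = -inner ℂ (toL2 (pd v ψ)) (toL2 φ) := by
  have hd (χ : TestFn) : Differentiable ℝ (χ : ℝ × ℝ → ℂ) := χ.contDiff.differentiable (by simp)
  have hcd (p : ℝ × ℝ) : fderiv ℝ (fun q => conj (ψ q)) p v = conj (pd v ψ p) := by
    have h : HasFDerivAt (fun q => conj (ψ q)) _ p :=
      (Complex.conjCLE : ℂ →L[ℝ] ℂ).hasFDerivAt.comp p (hd ψ p).hasFDerivAt
    rw [h.fderiv]
    rfl
  have hint (χ η : TestFn) : Integrable fun p => conj (χ p) * η p :=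
    ((Complex.continuous_conj.comp χ.continuous).mul η.continuous).integrable_of_hasCompactSupport
      η.hasCompactSupport.mul_left
  have h := integral_mul_fderiv_eq_neg_fderiv_mul_of_integrable (𝕜 := ℂ) (μ := volume) (v := v)
    (f := fun q => conj (ψ q)) (g := φ) (by simp only [hcd]; exact hint _ _)
    (hint ψ (pd v φ)) (hint ψ φ)
    (fun p _ => (Complex.conjCLE : ℂ →L[ℝ] ℂ).differentiableAt.comp p (hd ψ p))
    (fun p _ => hd φ p)
  simp only [hcd] at h
  simp only [inner_toL2, mul_comm _ (conj _)]
  exact h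

/-- The partial delta-derivatives `∂/∂r - (α + 1/2) / r` and `r (∂/∂s - (β + 1/2) / s)` on test
functions. -/
noncomputable def delta (α β : ℝ) : Fin 2 → (TestFn →ₗ[ℂ] TestFn)
  | 0 => dr - mulBy (fun p => (α + 1 / 2) / p.1 ^ 1) (contDiffOn_div_fst _ 1)
  -- Multiplication by `r` acts first here and last in `deltaDag`, so that taking adjoints factor by
  -- factor matches the two.
  | 1 => (ds - mulBy (fun p => (β + 1 / 2) / p.2 ^ 1) (contDiffOn_div_snd _ 1)) ∘ₗ
      mulBy (fun p => p.1 ^ 1) (contDiffOn_pow_fst 1)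

/-- Derivatives are antisymmetric, multiplications by real functions are symmetric, and adjoints
reverse compositions. -/
theorem inner_toL2_deltaDag (α β : ℝ) (j : Fin 2) (ψ φ : TestFn) :
    inner ℂ (toL2 ψ) (toL2 (deltaDag α β j φ)) = inner ℂ (toL2 (delta α β j ψ)) (toL2 φ) := by
  fin_cases j
  · simp [deltaDag, delta, dr, inner_sub_left, inner_sub_right, inner_toL2_pd, inner_toL2_mulBy]
  · simp [deltaDag, delta, ds, inner_sub_left, inner_sub_right, inner_toL2_pd, inner_toL2_mulBy]

theorem isWeakDelta_toL2 (α β : ℝ) (j : Fin 2) (φ : TestFn) :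
    IsWeakDelta α β j (toL2 φ) (toL2 (delta α β j φ)) :=
  (isWeakDelta_iff α β j _ _).2 fun ψ => inner_toL2_deltaDag α β j φ ψ

theorem fderiv_div_fst (c : ℝ) {p : ℝ × ℝ} (hp : p ∈ quadrant) :
    fderiv ℝ (fun q : ℝ × ℝ => c / q.1 ^ 1) p (1, 0) = -c / p.1 ^ 2 := by
  have hp' : p.1 ≠ 0 := ne_of_gt hp.1
  have h := ((hasDerivAt_inv hp').const_mul c).comp_hasFDerivAt p
    (hasFDerivAt_fst (𝕜 := ℝ) (p := p))
  have h' : HasFDerivAt (fun q : ℝ × ℝ => c / q.1 ^ 1) _ p :=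
    h.congr_of_eventuallyEq (Eventually.of_forall fun q => by simp [div_eq_mul_inv])
  rw [h'.fderiv]
  simp
  ring

theorem fderiv_div_snd (c : ℝ) {p : ℝ × ℝ} (hp : p ∈ quadrant) :
    fderiv ℝ (fun q : ℝ × ℝ => c / q.2 ^ 1) p (0, 1) = -c / p.2 ^ 2 := by
  have hp' : p.2 ≠ 0 := ne_of_gt hp.2
  have h := ((hasDerivAt_inv hp').const_mul c).comp_hasFDerivAt p
    (hasFDerivAt_snd (𝕜 := ℝ) (p := p))
  have h' : HasFDerivAt (fun q : ℝ × ℝ => c / q.2 ^ 1) _ p :=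
    h.congr_of_eventuallyEq (Eventually.of_forall fun q => by simp [div_eq_mul_inv])
  rw [h'.fderiv]
  simp
  ring

/-- The factor `r` does not depend on `s`; this lets the two factors `r` of `δ₂† δ₂` combine into
`r²`. -/
theorem ds_mulBy_fst (φ : TestFn) :
    ds (mulBy (fun p => p.1 ^ 1) (contDiffOn_pow_fst 1) φ) =
      mulBy (fun p => p.1 ^ 1) (contDiffOn_pow_fst 1) (ds φ) := by
  refine TestFn.ext_quadrant fun p hp => ?_
  have h : fderiv ℝ (fun q : ℝ × ℝ => q.1 ^ 1) p (0, 1) = 0 := by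
    simp only [pow_one]
    rw [fderiv_fst]
    rfl
  rw [ds, pd_mulBy_apply _ _ _ hp, h, mulBy_apply]
  simp

/-- The factorization of the Grushin expression by the delta-derivatives. -/
theorem sum_deltaDag_delta (α β : ℝ) (φ : TestFn) :
    ∑ j : Fin 2, deltaDag α β j (delta α β j φ) = grushinExpr α β φ := by
  refine TestFn.ext_quadrant fun p hp => ?_
  have hr : (p.1 : ℂ) ≠ 0 := Complex.ofReal_ne_zero.2 (ne_of_gt hp.1)
  have hs : (p.2 : ℂ) ≠ 0 := Complex.ofReal_ne_zero.2 (ne_of_gt hp.2)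
  have h1 := pd_mulBy_apply (1, 0) (contDiffOn_div_fst (α + 1 / 2) 1) φ hp
  have h2 := pd_mulBy_apply (0, 1) (contDiffOn_div_snd (β + 1 / 2) 1)
    (mulBy (fun p => p.1 ^ 1) (contDiffOn_pow_fst 1) φ) hp
  rw [fderiv_div_fst _ hp] at h1
  rw [fderiv_div_snd _ hp] at h2
  rw [← dr] at h1
  rw [← ds, ds_mulBy_fst] at h2
  simp only [Fin.sum_univ_two, deltaDag, delta, grushinExpr, LinearMap.sub_apply,
    LinearMap.add_apply, LinearMap.neg_apply, LinearMap.comp_apply, map_sub, ds_mulBy_fst,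
    FunLike.coe_add, FunLike.coe_sub, FunLike.coe_neg, Pi.add_apply, Pi.sub_apply,
    Pi.neg_apply, mulBy_apply, h1, h2]
  -- First-order terms cancel. The potentials agree since `a² - a = α² - 1/4` for `a = α + 1/2`, and
  -- likewise for `β`.
  push_cast
  field_simp
  ring

end Grushin

namespace Grushin

/-! ### The delta-Sobolev spaces and their forms -/

theorem formT_apply (α β : ℝ) (f g : deltaSobolev α β) :
    (formT α β).toFun f g = ∑ j : Fin 2, inner ℂ (weakDelta α β j g) (weakDelta α β j f) :=
  integral_weakDelta α β f g

/-- This turns closedness of the form into completeness of the Sobolev space. -/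
theorem formT_formNorm (α β : ℝ) (f : deltaSobolev α β) :
    (formT α β).formNorm f = sobolevNorm α β f := by
  have h : (inner ℂ (f : L2) (f : L2)).re = ‖(f : L2)‖ ^ 2 := by
    rw [inner_self_eq_norm_sq_to_K]
    norm_cast
  rw [sobolevNorm, sobolevInner, ← formT_apply, Complex.add_re, h, add_comm]
  rfl

theorem sobolevNorm_nonneg (α β : ℝ) (f : deltaSobolev α β) : 0 ≤ sobolevNorm α β f :=
  Real.sqrt_nonneg _

theorem toL2_mem_deltaSobolev (α β : ℝ) (φ : TestFn) : toL2 φ ∈ deltaSobolev α β :=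
  fun j => ⟨toL2 (delta α β j φ), isWeakDelta_toL2 α β j φ⟩

theorem toL2_mem_deltaSobolevZero (α β : ℝ) (φ : TestFn) : toL2 φ ∈ deltaSobolevZero α β := by
  refine ⟨toL2_mem_deltaSobolev α β φ, fun _ => ⟨toL2 φ, toL2_mem_deltaSobolev α β φ⟩,
    fun _ => ⟨φ, rfl⟩, ?_⟩
  simp [sobolevNorm_eq]

theorem weakDelta_toL2 (α β : ℝ) (j : Fin 2) (φ : TestFn) :
    weakDelta α β j ⟨toL2 φ, toL2_mem_deltaSobolev α β φ⟩ = toL2 (delta α β j φ) :=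
  (weakDelta_spec α β j ⟨toL2 φ, toL2_mem_deltaSobolev α β φ⟩).unique (isWeakDelta_toL2 α β j φ)

theorem dense_range_toL2 : Dense (LinearMap.range toL2 : Set L2) := by
  rw [Submodule.dense_iff_topologicalClosure_eq_top,
    Submodule.topologicalClosure_eq_top_iff, Submodule.eq_bot_iff]
  exact fun g hg => eq_zero_of_inner_toL2 g fun φ =>
    (Submodule.mem_orthogonal' _ g).1 hg _ ⟨φ, rfl⟩

theorem range_toL2_le_deltaSobolevZero (α β : ℝ) :
    LinearMap.range toL2 ≤ deltaSobolevZero α β := by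
  rintro _ ⟨φ, rfl⟩
  exact toL2_mem_deltaSobolevZero α β φ

/-- Each `δⱼ φ` is itself a test function, so the weak derivative of `g` can be tested against it,
which produces `δⱼ† δⱼ φ`. No approximation of `g` by test functions is needed. -/
theorem formT_toL2 (α β : ℝ) (φ : TestFn) (g : deltaSobolev α β) :
    (formT α β).toFun ⟨toL2 φ, toL2_mem_deltaSobolev α β φ⟩ g =
      inner ℂ (g : L2) (toL2 (grushinExpr α β φ)) := by
  have h (j : Fin 2) := (isWeakDelta_iff α β j _ _).1 (weakDelta_spec α β j g)
  refine (formT_apply α β ⟨toL2 φ, toL2_mem_deltaSobolev α β φ⟩ g).trans ?_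
  rw [← sum_deltaDag_delta, map_sum, inner_sum]
  simp only [weakDelta_toL2, h]

/-- The delta-Sobolev space is complete. -/
theorem exists_tendsto_sobolevNorm {α β : ℝ} {u : ℕ → deltaSobolev α β}
    (hu : CauchySeq fun n => sobolevEmbed α β (u n)) :
    ∃ f : deltaSobolev α β, Tendsto (fun n => sobolevNorm α β (u n - f)) atTop (𝓝 0) := by
  obtain ⟨F, hF⟩ := cauchySeq_tendsto_of_complete hu
  have hfst : Tendsto (fun n => (u n : L2)) atTop (𝓝 F.fst) :=
    ((WithLp.prod_continuous_ofLp 2 _ _).fst.tendsto F).comp hF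
  have hsnd (j : Fin 2) : Tendsto (fun n => weakDelta α β j (u n)) atTop (𝓝 (F.snd j)) :=
    ((((PiLp.continuous_ofLp 2 _).comp
      (WithLp.prod_continuous_ofLp 2 _ _).snd).tendsto F).comp hF).apply_nhds j
  -- The defining identity pairs with fixed `L²` functions, so it survives the limits of `u n` and
  -- of its derivatives.
  have hw (j : Fin 2) : IsWeakDelta α β j F.fst (F.snd j) := by
    refine (isWeakDelta_iff α β j _ _).2 fun φ => ?_
    refine tendsto_nhds_unique (hfst.inner (𝕜 := ℂ) tendsto_const_nhds) ?_
    refine ((hsnd j).inner (𝕜 := ℂ) tendsto_const_nhds).congr fun n => ?_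
    exact ((isWeakDelta_iff α β j _ _).1 (weakDelta_spec α β j (u n)) φ).symm
  let f : deltaSobolev α β := ⟨F.fst, fun j => ⟨F.snd j, hw j⟩⟩
  have hf : sobolevEmbed α β f = F := by
    refine WithLp.ofLp_injective 2 (Prod.ext rfl (WithLp.ofLp_injective 2 (funext fun j => ?_)))
    exact (weakDelta_spec α β j f).unique (hw j)
  refine ⟨f, ?_⟩
  simp only [sobolevNorm_eq, map_sub, hf]
  exact tendsto_iff_norm_sub_tendsto_zero.1 hF

theorem cauchySeq_sobolevEmbed {α β : ℝ} {u : ℕ → deltaSobolev α β}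
    (hu : ∀ ε : ℝ, 0 < ε → ∃ N : ℕ, ∀ m n : ℕ, N ≤ m → N ≤ n →
      sobolevNorm α β (u m - u n) < ε) :
    CauchySeq fun n => sobolevEmbed α β (u n) := by
  refine Metric.cauchySeq_iff.2 fun ε hε => ?_
  obtain ⟨N, hN⟩ := hu ε hε
  refine ⟨N, fun m hm n hn => ?_⟩
  rw [dist_eq_norm, ← map_sub, ← sobolevNorm_eq]
  exact hN m n hm hn

theorem formT_isClosed (α β : ℝ) : (formT α β).IsClosed := by
  intro u hu
  obtain ⟨f, hf⟩ := exists_tendsto_sobolevNorm (u := u) <| cauchySeq_sobolevEmbed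
    fun ε hε => (hu ε hε).imp fun N hN m n hm hn => formT_formNorm α β _ ▸ hN m n hm hn
  exact ⟨f, hf.congr fun n => (formT_formNorm α β _).symm⟩

/-- The closure of the test functions is closed under Sobolev limits. -/
theorem mem_deltaSobolevZero_of_tendsto {α β : ℝ} {u : ℕ → deltaSobolev α β}
    (hu : ∀ n, (u n : L2) ∈ deltaSobolevZero α β) {f : deltaSobolev α β}
    (hf : Tendsto (fun n => sobolevNorm α β (u n - f)) atTop (𝓝 0)) :
    (f : L2) ∈ deltaSobolevZero α β := by
  -- Diagonal choice: a test function within `1 / (n + 1)` of `u n`.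
  have happrox (n : ℕ) : ∃ v : deltaSobolev α β, (∃ φ : TestFn, (v : L2) = toL2 φ) ∧
      sobolevNorm α β (v - u n) < 1 / ((n : ℝ) + 1) := by
    obtain ⟨_, v, hv, hlim⟩ := hu n
    obtain ⟨k, hk⟩ := (hlim.eventually (gt_mem_nhds Nat.one_div_pos_of_nat)).exists
    exact ⟨v k, hv k, hk⟩
  choose v hv hlt using happrox
  refine ⟨f.2, v, hv, ?_⟩
  refine squeeze_zero (fun n => sobolevNorm_nonneg α β _) (fun n => ?_)
    (add_zero (0 : ℝ) ▸ (tendsto_one_div_add_atTop_nhds_zero_nat (𝕜 := ℝ)).add hf)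
  have h : v n - ⟨f, f.2⟩ = (v n - u n) + (u n - f) := (sub_add_sub_cancel _ _ _).symm
  rw [h]
  exact (sobolevNorm_add_le α β _ _).trans (add_le_add (hlt n).le le_rfl)

theorem formTZero_formNorm (α β : ℝ) (f : deltaSobolevZero α β) :
    (formTZero α β).formNorm f =
      sobolevNorm α β (Submodule.inclusion (deltaSobolevZero_le α β) f) :=
  formT_formNorm α β (Submodule.inclusion (deltaSobolevZero_le α β) f)

theorem formTZero_formNorm_sub (α β : ℝ) (f g : deltaSobolevZero α β) :
    (formTZero α β).formNorm ((f : (formTZero α β).domain) - (g : (formTZero α β).domain)) =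
      sobolevNorm α β (Submodule.inclusion (deltaSobolevZero_le α β) f -
        Submodule.inclusion (deltaSobolevZero_le α β) g) :=
  formTZero_formNorm α β (f - g)

/-- A Cauchy sequence converges in the full Sobolev space, and its limit stays in the closed
subspace. -/
theorem formTZero_isClosed (α β : ℝ) : (formTZero α β).IsClosed := by
  intro (u : ℕ → deltaSobolevZero α β) hu
  obtain ⟨f, hf⟩ := exists_tendsto_sobolevNorm
    (u := fun n => Submodule.inclusion (deltaSobolevZero_le α β) (u n)) <| cauchySeq_sobolevEmbed
    fun ε hε => (hu ε hε).imp fun N hN m n hm hn =>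
      (formTZero_formNorm_sub α β (u m) (u n)).symm.trans_lt (hN m n hm hn)
  have hf₀ : (f : L2) ∈ deltaSobolevZero α β :=
    mem_deltaSobolevZero_of_tendsto (fun n => (u n).2) hf
  exact ⟨⟨f, hf₀⟩, hf.congr fun n => (formTZero_formNorm_sub α β (u n) ⟨f, hf₀⟩).symm⟩

theorem formT_isHermitian (α β : ℝ) : (formT α β).IsHermitian := by
  intro f g
  refine (formT_apply α β f g).trans (.trans ?_ (congrArg conj (formT_apply α β g f)).symm)
  rw [map_sum]
  simp only [inner_conj_symm]

theorem formT_isNonneg (α β : ℝ) : (formT α β).IsNonneg := by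
  intro f
  have h := formT_apply α β f f
  refine h ▸ ?_
  rw [Complex.re_sum, Complex.im_sum]
  exact ⟨Finset.sum_nonneg fun j _ => inner_self_nonneg (𝕜 := ℂ),
    Finset.sum_eq_zero fun j _ => inner_self_im (𝕜 := ℂ) _⟩

theorem formTZero_isHermitian (α β : ℝ) : (formTZero α β).IsHermitian := fun f g =>
  formT_isHermitian α β (Submodule.inclusion (deltaSobolevZero_le α β) f)
    (Submodule.inclusion (deltaSobolevZero_le α β) g)

theorem formTZero_isNonneg (α β : ℝ) : (formTZero α β).IsNonneg := fun f =>
  formT_isNonneg α β (Submodule.inclusion (deltaSobolevZero_le α β) f)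

theorem formTZero_isDenselyDefined (α β : ℝ) : (formTZero α β).IsDenselyDefined :=
  dense_range_toL2.mono (range_toL2_le_deltaSobolevZero α β)

theorem formT_isDenselyDefined (α β : ℝ) : (formT α β).IsDenselyDefined :=
  (formTZero_isDenselyDefined α β).mono (deltaSobolevZero_le α β)

/-! ### The Grushin operator -/

theorem grushinOp_apply (α β : ℝ) (φ : TestFn) :
    grushinOp α β ⟨toL2 φ, φ, rfl⟩ = toL2 (grushinExpr α β φ) := by
  have h : (LinearEquiv.ofInjective toL2 toL2_injective).symm ⟨toL2 φ, φ, rfl⟩ = φ :=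
    (LinearEquiv.symm_apply_eq _).2 rfl
  exact congrArg (fun ψ => toL2 (grushinExpr α β ψ)) h

theorem mem_grushinOp_graph {α β : ℝ} {p : L2 × L2} (hp : p ∈ (grushinOp α β).graph) :
    ∃ φ : TestFn, p = (toL2 φ, toL2 (grushinExpr α β φ)) := by
  obtain ⟨⟨_, φ, rfl⟩, h1, h2⟩ := (LinearPMap.mem_graph_iff _).1 hp
  rw [grushinOp_apply] at h2
  exact ⟨φ, Prod.ext h1.symm h2.symm⟩

theorem grushinOp_le_opD (α β : ℝ) : grushinOp α β ≤ opD α β := by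
  refine LinearPMap.le_of_le_graph fun p hp => ?_
  obtain ⟨φ, rfl⟩ := mem_grushinOp_graph hp
  rw [opD, SesqForm.assocOp_graph _ (formT_isDenselyDefined α β)]
  exact ⟨toL2_mem_deltaSobolev α β φ, fun g => formT_toL2 α β φ g⟩

theorem grushinOp_le_opDZero (α β : ℝ) : grushinOp α β ≤ opDZero α β := by
  refine LinearPMap.le_of_le_graph fun p hp => ?_
  obtain ⟨φ, rfl⟩ := mem_grushinOp_graph hp
  rw [opDZero, SesqForm.assocOp_graph _ (formTZero_isDenselyDefined α β)]
  exact ⟨toL2_mem_deltaSobolevZero α β φ, fun g =>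
    formT_toL2 α β φ (Submodule.inclusion (deltaSobolevZero_le α β) g)⟩

/-- Through this identity `G°` inherits symmetry and nonnegativity from `𝔱°`. -/
theorem ofOperator_grushinOp_apply (α β : ℝ) (φ ψ : TestFn) :
    (SesqForm.ofOperator (grushinOp α β)).toFun ⟨toL2 φ, φ, rfl⟩ ⟨toL2 ψ, ψ, rfl⟩ =
      (formT α β).toFun ⟨toL2 φ, toL2_mem_deltaSobolev α β φ⟩
        ⟨toL2 ψ, toL2_mem_deltaSobolev α β ψ⟩ := by
  refine .trans ?_ (formT_toL2 α β φ ⟨toL2 ψ, toL2_mem_deltaSobolev α β ψ⟩).symm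
  exact congrArg (inner ℂ (toL2 ψ)) (grushinOp_apply α β φ)

theorem grushinOp_isFormalAdjoint (α β : ℝ) :
    (grushinOp α β).IsFormalAdjoint (grushinOp α β) := by
  rintro ⟨_, φ, rfl⟩ ⟨_, ψ, rfl⟩
  rw [← inner_conj_symm]
  have h := formT_isHermitian α β ⟨toL2 ψ, toL2_mem_deltaSobolev α β ψ⟩
    ⟨toL2 φ, toL2_mem_deltaSobolev α β φ⟩
  rw [← ofOperator_grushinOp_apply, ← ofOperator_grushinOp_apply] at h
  exact h.symm

theorem grushinOp_isNonnegOp (α β : ℝ) : IsNonnegOp (grushinOp α β) := by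
  rintro ⟨_, φ, rfl⟩
  have h := formT_isNonneg α β ⟨toL2 φ, toL2_mem_deltaSobolev α β φ⟩
  rw [← ofOperator_grushinOp_apply] at h
  exact h

/-- Density in the form norm is the very definition of `deltaSobolevZero`; its approximating
sequence is reused, read inside the smaller domain. -/
theorem formTZero_isClosureOf (α β : ℝ) :
    (formTZero α β).IsClosureOf (SesqForm.ofOperator (grushinOp α β)) := by
  refine ⟨formTZero_isHermitian α β, formTZero_isNonneg α β, formTZero_isClosed α β,
    ⟨range_toL2_le_deltaSobolevZero α β, ?_⟩, ?_⟩
  · rintro ⟨_, φ, rfl⟩ ⟨_, ψ, rfl⟩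
    exact (ofOperator_grushinOp_apply α β φ ψ).symm
  · rintro ⟨f, hf, u, hu, hlim⟩
    have hu₀ (n : ℕ) : (u n : L2) ∈ deltaSobolevZero α β := by
      obtain ⟨φ, hφ⟩ := hu n
      exact hφ ▸ toL2_mem_deltaSobolevZero α β φ
    refine ⟨fun n => ⟨u n, hu₀ n⟩, fun n => ?_, hlim.congr fun n => ?_⟩
    · obtain ⟨φ, hφ⟩ := hu n
      exact ⟨φ, hφ.symm⟩
    · exact (formTZero_formNorm_sub α β ⟨u n, hu₀ n⟩ ⟨f, hf, u, hu, hlim⟩).symm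

theorem opDZero_isFriedrichsExtension (α β : ℝ) :
    IsFriedrichsExtension (grushinOp α β) (opDZero α β) :=
  ⟨dense_range_toL2, grushinOp_isFormalAdjoint α β, grushinOp_isNonnegOp α β,
    formTZero α β, formTZero_isClosureOf α β, rfl⟩

end Grushin

theorem theorem5p1 (α β : ℝ) (hα : -1 < α) (hβ : -1 < β) :
    ((Grushin.formT α β).IsDenselyDefined ∧ (Grushin.formT α β).IsHermitian ∧
      (Grushin.formT α β).IsNonneg ∧ (Grushin.formT α β).IsClosed) ∧
    ((Grushin.formTZero α β).IsDenselyDefined ∧ (Grushin.formTZero α β).IsHermitian ∧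
      (Grushin.formTZero α β).IsNonneg ∧ (Grushin.formTZero α β).IsClosed) ∧
    (IsSelfAdjoint (Grushin.opD α β) ∧ Grushin.IsNonnegOp (Grushin.opD α β) ∧
      Grushin.grushinOp α β ≤ Grushin.opD α β) ∧
    (IsSelfAdjoint (Grushin.opDZero α β) ∧ Grushin.IsNonnegOp (Grushin.opDZero α β) ∧
      Grushin.grushinOp α β ≤ Grushin.opDZero α β) ∧
    Grushin.IsFriedrichsExtension (Grushin.grushinOp α β) (Grushin.opDZero α β) := by
  open Grushin in
  have hd := formT_isDenselyDefined α β
  have hh := formT_isHermitian α β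
  have hn := formT_isNonneg α β
  have hc := formT_isClosed α β
  have hd₀ := formTZero_isDenselyDefined α β
  have hh₀ := formTZero_isHermitian α β
  have hn₀ := formTZero_isNonneg α β
  have hc₀ := formTZero_isClosed α β
  exact ⟨⟨hd, hh, hn, hc⟩, ⟨hd₀, hh₀, hn₀, hc₀⟩,
    ⟨hc.isSelfAdjoint_assocOp hh hn hd, hn.assocOp hd, grushinOp_le_opD α β⟩,
    ⟨hc₀.isSelfAdjoint_assocOp hh₀ hn₀ hd₀, hn₀.assocOp hd₀, grushinOp_le_opDZero α β⟩,
    opDZero_isFriedrichsExtension α β⟩
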